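/- **Setting.** There are $n$ independent arms. A play of arm $i$ shows one of finitely many outcomes, each carrying a nonnegative reward value. The law $D_i$ of the outcomes is unknown; it is drawn once from a given prior $\mathcal D_i$, and given $D_i$ the outcomes of the plays are i.i.d. with law $D_i$. The outcome of a play is learned only after a delay of $\delta_i\in\mathbb N$ steps: the decision at step $t$ may use exactly the outcomes of the plays made at steps $s$ with $s+\delta_i<t$. Arm $i$ has a budget $B_i\in[0,\infty]$: a play accrues its reward value if the values of the earlier outcomes of the arm sum to less than $B_i$, and accrues $0$ otherwise. A single-arm policy with horizon $H$ is a (randomized) rule that at each of the steps $1,\dots,H$ plays the arm or does not (waits or has quit), based on the outcomes known so far. $R(\mathcal P)$ and $N(\mathcal P)$ denote its expected reward and its expected number of plays. For a horizon $T$, $$LP1=\max\Big\{\sum_i R(\mathcal P_i)\ \Big|\ \mathcal P_i \text{ a single-arm policy of arm } i \text{ with horizon } T,\ \sum_i N(\mathcal P_i)\le T\Big\}.$$ Divide time into blocks of $2\delta_i+1$ steps. A block is regular if the policy makes at most $\delta_i+1$ consecutive plays at its start and then waits for the rest of the block. A policy for arm $i$ is $c$-delay-free if, on every decision path, the blocks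 before the first block with at least $c\,\delta_i$ plays are regular, and from that block on the policy plays at every step, without waiting, until it stops. With $Q_i=T/\delta_i$, it is $(\alpha,c)$-well-structured if it is $c$-delay-free and on every decision path it switches, after at most $(\alpha+o(1))Q_i$ blocks, to playing at every step until it stops. It is truncated if it stops within the first $\lfloor T/2\rfloor$ steps. **Theorem.** Let $0<\alpha\le 1/8$, put $\gamma=2(1+1/\alpha)(1+2/\alpha)$, and assume $\delta_i=o(T/\log T)$ uniformly in $i$, that is, $\delta_i\le d(T)$ for all $i$, where $d(T)=o(T/\log T)$. Then there is a function $\varepsilon(T)\to0$, depending only on $\alpha$ and $d$, such that for all sufficiently large $T$ (how large depends only on $\alpha$ and $d$) and for every instance with any number of arms and with delays $\delta_i\le d(T)$: the objective values of the feasible solutions of $LP1$ are bounded above, and there are truncated $(\alpha,\frac{\alpha}{\alpha+2})$-well-structured single-arm policies $\mathcal P'_i$, one for each arm, with horizon $\lfloor T/2\rfloor$ and with $\varepsilon(T)$ as the $o(1)$ term, such that $$\sum_i N(\mathcal P'_i)\le\gamma T\qquad\text{and}\qquad LP1\le\frac1\alpha\sum_i R(\mathcal P'_i),$$ where $LP1$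 stands for the supremum of these values. -/

import Mathlib

open MeasureTheory Filter Topology Asymptotics
open scoped ENNReal

noncomputable section

/-- An arm of the Bayesian bandit. A play shows one of finitely many outcomes; the unknown outcome
distribution `D` (a point of the probability simplex) is drawn once from `prior`, and conditionally
on `D` the outcomes of the plays are independent with law `D`. `budget = ⊤` means no budget. -/
structure Arm where
  numOutcomes : ℕ
  value : Fin numOutcomes → ℝ
  value_nonneg : ∀ o, 0 ≤ value o
  prior : Measure (Fin numOutcomes → ℝ)
  prior_prob : IsProbabilityMeasure prior
  prior_simplex : ∀ᵐ D ∂prior, D ∈ stdSimplex ℝ (Fin numOutcomes)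
  delay : ℕ
  budget : ℝ≥0∞

/-- Number of plays at the time steps `0, …, t - 1` of a trajectory (`a s = true` means that a play
is made at step `s`). -/
def playsBefore (a : ℕ → Bool) (t : ℕ) : ℕ :=
  ((Finset.range t).filter (fun s => a s = true)).card

/-- A deterministic single-arm policy with feedback delay `δ` that makes plays only at the time
steps `0, …, H - 1`. The outcome of the `j`-th play (counted from `0`) is entry `j` of the tape `w`
(in the uses below `H ≤ T`, so that the tape is long enough), and `play w t` tells whether a play is
made at step `t`. The outcome of a play made at step `s` is known at step `t` iff `s + δ < t`, so
that the decision at step `t` may depend only on the outcomes of the first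
`playsBefore (play w) (t - δ)` plays. Not playing covers both waiting and having quit. -/
structure DetPolicy (k δ T H : ℕ) where
  play : (Fin T → Fin k) → ℕ → Bool
  horizon : ∀ w t, H ≤ t → play w t = false
  adapted : ∀ w w' t,
    (∀ j : Fin T, (j : ℕ) < playsBefore (play w) (t - δ) → w j = w' j) → play w t = play w' t

/-- The number of plays made on the outcome tape `w`. -/
def DetPolicy.numPlays {k δ T H : ℕ} (p : DetPolicy k δ T H) (w : Fin T → Fin k) : ℕ :=
  playsBefore (p.play w) H

namespace Arm

variable (A : Arm)

/-- The probability of the outcome tape `w` when the outcome distribution is `D`. -/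
def tapeProb {T : ℕ} (D : Fin A.numOutcomes → ℝ) (w : Fin T → Fin A.numOutcomes) : ℝ :=
  ∏ j, D (w j)

/-- Expectation of a function of the outcomes, over the prior and the outcomes. -/
def expect {T : ℕ} (f : (Fin T → Fin A.numOutcomes) → ℝ) : ℝ :=
  ∫ D, ∑ w, A.tapeProb D w * f w ∂A.prior

open Classical in
/-- Reward accrued by play `j`: the value of its outcome, or `0` if the outcomes of the earlier
plays have already used up the budget. -/
def playReward {T : ℕ} (w : Fin T → Fin A.numOutcomes) (j : Fin T) : ℝ :=
  if ENNReal.ofReal (∑ j' ∈ Finset.univ.filter (fun j' : Fin T => j' < j), A.value (w j')) < A.budget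
  then A.value (w j) else 0

/-- Total reward accrued by a deterministic policy on the outcome tape `w`. -/
def totalReward {T H : ℕ} (p : DetPolicy A.numOutcomes A.delay T H)
    (w : Fin T → Fin A.numOutcomes) : ℝ :=
  ∑ j ∈ Finset.univ.filter (fun j : Fin T => (j : ℕ) < p.numPlays w), A.playReward w j

/-- A (randomized) single-arm policy with horizon `H`. The parameter `T` is only the length of the
outcome tape. -/
abbrev Policy (T H : ℕ) : Type := PMF (DetPolicy A.numOutcomes A.delay T H)

variable {A}

/-- `N(P)`, the expected number of plays. -/
def Policy.N {T H : ℕ} (P : A.Policy T H) : ℝ :=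
  ∑' p, (P p).toReal * A.expect (fun w => (p.numPlays w : ℝ))

/-- `R(P)`, the expected reward. -/
def Policy.R {T H : ℕ} (P : A.Policy T H) : ℝ :=
  ∑' p, (P p).toReal * A.expect (fun w => A.totalReward p w)

end Arm

/-- The objective values of the feasible solutions of `LP1`: one policy of horizon `T` for each arm,
with at most `T` expected plays in total. -/
def lp1Values {n : ℕ} (arms : Fin n → Arm) (T : ℕ) : Set ℝ :=
  {v | ∃ P : ∀ i, (arms i).Policy T T,
    (∑ i, Arm.Policy.N (P i)) ≤ (T : ℝ) ∧ v = ∑ i, Arm.Policy.R (P i)}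

/-- The optimum of `LP1`. -/
def lp1 {n : ℕ} (arms : Fin n → Arm) (T : ℕ) : ℝ := sSup (lp1Values arms T)

/-- First time step of block `b`; blocks have `2 * δ + 1` steps. -/
def blockStart (δ b : ℕ) : ℕ := b * (2 * δ + 1)

/-- Number of plays in block `b`. -/
def blockPlays (δ : ℕ) (a : ℕ → Bool) (b : ℕ) : ℕ :=
  ((Finset.range (2 * δ + 1)).filter (fun j => a (blockStart δ b + j) = true)).card

/-- Block `b` is as in a block-structured policy: at most `δ + 1` consecutive plays at its start,
then waiting until its end. -/
def IsRegularBlock (δ : ℕ) (a : ℕ → Bool) (b : ℕ) : Prop :=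
  ∃ x ≤ δ + 1, ∀ j < 2 * δ + 1, (a (blockStart δ b + j) = true ↔ j < x)

/-- From step `s` on, a play is made at every step until the policy stops for good. -/
def PlaysContinuouslyFrom (a : ℕ → Bool) (s : ℕ) : Prop :=
  ∃ e, ∀ t, s ≤ t → (a t = true ↔ t < e)

/-- The trajectory is `c`-delay-free: it consists of regular blocks up to the first block with at
least `c * δ` plays, and from (the start of) that block on it plays without waiting until it
stops. -/
def IsDelayFree (c : ℝ) (δ : ℕ) (a : ℕ → Bool) : Prop :=
  ∀ b, (∀ b' < b, (blockPlays δ a b' : ℝ) < c * δ) →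
    ((blockPlays δ a b : ℝ) < c * δ → IsRegularBlock δ a b) ∧
    (c * δ ≤ (blockPlays δ a b : ℝ) → PlaysContinuouslyFrom a (blockStart δ b))

/-- The trajectory is `c`-delay-free, and after at most `q` blocks it plays continuously until it
stops. -/
def IsWellStructuredTrajectory (c q : ℝ) (δ : ℕ) (a : ℕ → Bool) : Prop :=
  IsDelayFree c δ a ∧ ∃ m : ℕ, (m : ℝ) ≤ q ∧ PlaysContinuouslyFrom a (blockStart δ m)

/-- The policy `P` of arm `A` is `(α, c)`-well-structured, where `ε` is the value of the `o(1)` term: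
each of its decision paths is `c`-delay-free and switches to continuous play after at most
`(α + ε) * (T / δ)` blocks. -/
def Arm.Policy.IsWellStructured {A : Arm} {T H : ℕ} (P : A.Policy T H) (α c ε : ℝ) : Prop :=
  ∀ p ∈ P.support, ∀ w,
    IsWellStructuredTrajectory c ((α + ε) * ((T : ℝ) / A.delay)) A.delay (p.play w)

end

/-!
Fix an arm with delay `δ` and a deterministic policy `p` for it. The new policy follows a schedule
of play times that is fixed in advance, and it stops as soon as the outcomes known to it show that
`p` makes no further plays. It can tell, since the first `j` outcomes determine whether `p` makes
more than `j` plays (`DetPolicy.lt_numPlays_of_agree`). So, on every tape, it makes all the plays of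
`p`, unless the horizon cuts it short (`DetPolicy.min_le_numPlays_stopSchedule`).

The schedule plays `2 ^ b` times at the start of block `b`, as long as `2 ^ b < c * δ`, and without
waiting from the next block, number `L`, on. The trajectories are therefore well-structured.
As block `b` is entered only if `p` makes at least `2 ^ b` plays, the new policy makes fewer than
twice as many plays as `p` before block `L`; from block `L` on it makes at most `δ` plays more than
`p`, which then makes at least `2 ^ L ≥ c * δ` plays. Altogether the number of plays grows at
most by the factor `1 + 1 / c = 2 * (1 + 1 / α)` (`DetPolicy.numPlays_stop_doublingSchedule_le`),
which is below the required `2 * (1 + 1 / α) * (1 + 2 / α)`.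

Since `L = O(log T)` and `δ = o(T / log T)`, the first `L` blocks take `o(T)` steps
(`eventually_doublingBlocks_mul_le`), so that within the horizon `T / 2` at least the first `T / 4`
plays of `p` are made. These carry a quarter of the reward of `p`: the outcomes are exchangeable,
and whether a play is made and rewarded depends on the earlier outcomes only, so that the expected
reward drawn from play `j` decreases with `j` (`Arm.antitone_expectedPlayReward`,
`Arm.mul_expect_totalReward_le`). For a feasible solution of value at least half the optimum
this leaves an eighth of the optimum, and `α ≤ 1 / 8`.
-/

/-! ### Counting plays -/

lemma playsBefore_zero (a : ℕ → Bool) : playsBefore a 0 = 0 := by simp [playsBefore]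

lemma playsBefore_succ (a : ℕ → Bool) (t : ℕ) :
    playsBefore a (t + 1) = playsBefore a t + if a t = true then 1 else 0 := by
  unfold playsBefore
  rw [Finset.range_add_one, Finset.filter_insert]
  split_ifs <;> simp

lemma playsBefore_mono (a : ℕ → Bool) : Monotone (playsBefore a) :=
  monotone_nat_of_le_succ fun t => by rw [playsBefore_succ]; omega

lemma playsBefore_congr {a a' : ℕ → Bool} {t : ℕ} (h : ∀ s < t, a s = a' s) :
    playsBefore a t = playsBefore a' t := by
  unfold playsBefore
  congr 1
  refine Finset.filter_congr fun s hs => ?_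
  rw [h s (Finset.mem_range.1 hs)]

lemma playsBefore_le_of_imp {a a' : ℕ → Bool} (h : ∀ s, a s = true → a' s = true) (t : ℕ) :
    playsBefore a t ≤ playsBefore a' t :=
  Finset.card_le_card fun s hs => by
    simp only [Finset.mem_filter] at hs ⊢
    exact ⟨hs.1, h s hs.2⟩

lemma playsBefore_add_le (a : ℕ → Bool) (t n : ℕ) :
    playsBefore a (t + n) ≤ playsBefore a t + n := by
  induction n with
  | zero => simp
  | succ n ih => rw [← add_assoc, playsBefore_succ]; split_ifs <;> omega

lemma playsBefore_add_of_forall_true {a : ℕ → Bool} {t : ℕ} (h : ∀ s, t ≤ s → a s = true) (n : ℕ) :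
    playsBefore a (t + n) = playsBefore a t + n := by
  induction n with
  | zero => simp
  | succ n ih => rw [← add_assoc, playsBefore_succ, ih, if_pos (h _ (by omega))]; omega

/-- A decreasing predicate that fails at some point is the initial part of `[s, ∞)`. -/
lemma exists_forall_iff_lt_of_antitone {P : ℕ → Prop} {s H : ℕ}
    (hP : ∀ t u, s ≤ t → t ≤ u → P u → P t) (hH : ∀ t, H ≤ t → ¬ P t) :
    ∃ e, ∀ t, s ≤ t → (P t ↔ t < e) := by
  classical
  have hex : ∃ e, s ≤ e ∧ ¬ P e := ⟨max s H, le_max_left _ _, hH _ (le_max_right _ _)⟩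
  refine ⟨Nat.find hex, fun t hst => ⟨fun ht => ?_, fun ht => ?_⟩⟩
  · by_contra hlt
    exact (Nat.find_spec hex).2 (hP _ t (Nat.find_spec hex).1 (not_lt.1 hlt) ht)
  · by_contra hn
    exact Nat.find_min hex ht ⟨hst, hn⟩

/-! ### Stopping a fixed schedule -/

namespace DetPolicy

variable {k δ T H : ℕ}

/-- Whether a policy makes more than `j` plays is determined by the first `j` outcomes: as long as
at most `j` plays are made, all decisions depend on these outcomes only. -/
lemma lt_playsBefore_of_agree (p : DetPolicy k δ T H) {w w' : Fin T → Fin k} {j : ℕ}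
    (h : ∀ i : Fin T, (i : ℕ) < j → w i = w' i) (t : ℕ) (ht : j < playsBefore (p.play w) t) :
    j < playsBefore (p.play w') t := by
  induction t with
  | zero => simp [playsBefore_zero] at ht
  | succ t ih =>
    by_cases hj : j < playsBefore (p.play w) t
    · exact (ih hj).trans_le (playsBefore_mono _ t.le_succ)
    · have hs : ∀ s < t + 1, p.play w s = p.play w' s := fun s hs =>
        p.adapted w w' s fun i hi => h i <| hi.trans_le <|
          (playsBefore_mono _ (by omega : s - δ ≤ t)).trans (not_lt.1 hj)
      rwa [← playsBefore_congr hs]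

lemma lt_numPlays_of_agree (p : DetPolicy k δ T H) {w w' : Fin T → Fin k} {j : ℕ}
    (h : ∀ i : Fin T, (i : ℕ) < j → w i = w' i) (hj : j < p.numPlays w) : j < p.numPlays w' :=
  p.lt_playsBefore_of_agree h H hj

/-- The trajectory on the tape `w` of the policy that follows the schedule `σ` up to step `H'` and
stops once the number of known outcomes reaches the number of plays of `p`. -/
def stoppedPlay (p : DetPolicy k δ T H) (σ : ℕ → Bool) (H' : ℕ) (w : Fin T → Fin k) (t : ℕ) :
    Bool :=
  decide (t < H' ∧ σ t = true ∧ playsBefore σ (t - δ) < p.numPlays w)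

lemma stoppedPlay_iff {p : DetPolicy k δ T H} {σ : ℕ → Bool} {H' : ℕ} {w : Fin T → Fin k} {t : ℕ} :
    p.stoppedPlay σ H' w t = true ↔
      t < H' ∧ σ t = true ∧ playsBefore σ (t - δ) < p.numPlays w := by
  simp [stoppedPlay]

/-- The stopped schedule makes every scheduled play until it has caught up with `p`: a scheduled
play is skipped only if `p.numPlays w` outcomes are known already. -/
lemma min_le_playsBefore_stoppedPlay (p : DetPolicy k δ T H) (σ : ℕ → Bool) (H' : ℕ)
    (w : Fin T → Fin k) (t : ℕ) (ht : t ≤ H') :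
    min (p.numPlays w) (playsBefore σ t) ≤ playsBefore (p.stoppedPlay σ H' w) t := by
  induction t using Nat.strong_induction_on with
  | _ t ih =>
    cases t with
    | zero => simp [playsBefore_zero]
    | succ t =>
      have h1 := ih t (by omega) (by omega)
      rw [playsBefore_succ, playsBefore_succ]
      by_cases hσ : σ t = true
      · by_cases hk : playsBefore σ (t - δ) < p.numPlays w
        · rw [if_pos hσ, if_pos (stoppedPlay_iff.2 ⟨by omega, hσ, hk⟩)]
          omega
        · have h2 := ih (t - δ) (by omega) (by omega)
          have h3 := playsBefore_mono (p.stoppedPlay σ H' w) (by omega : t - δ ≤ t)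
          omega
      · rw [if_neg hσ]
        omega

/-- The policy that follows the schedule `σ` up to step `H'` and stops once the number of known
outcomes reaches the number of plays of `p`. It is a policy with feedback delay `δ` because
the known outcomes determine whether the number of plays of `p` exceeds their number. -/
def stopSchedule (p : DetPolicy k δ T H) (σ : ℕ → Bool) (H' : ℕ) : DetPolicy k δ T H' where
  play := p.stoppedPlay σ H'
  horizon w t ht := by simp [stoppedPlay, not_lt.2 ht]
  adapted w w' t h := by
    rw [Bool.eq_iff_iff, stoppedPlay_iff, stoppedPlay_iff]
    refine and_congr_right fun ht => and_congr_right fun _ => ?_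
    have h1 := p.min_le_playsBefore_stoppedPlay σ H' w (t - δ) (by omega)
    constructor
    · intro hk
      exact p.lt_numPlays_of_agree (fun i hi => h i (by omega)) hk
    · intro hk
      by_contra hn
      -- Both tapes agree on the first `p.numPlays w` outcomes, so `p` makes equally many plays.
      have := p.lt_numPlays_of_agree (w := w') (w' := w) (j := p.numPlays w)
        (fun i hi => (h i (by omega)).symm) (by omega)
      omega

lemma min_le_numPlays_stopSchedule (p : DetPolicy k δ T H) (σ : ℕ → Bool) (H' : ℕ)
    (w : Fin T → Fin k) :
    min (p.numPlays w) (playsBefore σ H') ≤ (p.stopSchedule σ H').numPlays w :=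
  p.min_le_playsBefore_stoppedPlay σ H' w H' le_rfl

lemma numPlays_stopSchedule_le (p : DetPolicy k δ T H) (σ : ℕ → Bool) (H' : ℕ)
    (w : Fin T → Fin k) {B : ℝ} (hB : 0 ≤ B)
    (h : ∀ t, σ t = true → playsBefore σ (t - δ) < p.numPlays w → (playsBefore σ (t + 1) : ℝ) ≤ B) :
    ((p.stopSchedule σ H').numPlays w : ℝ) ≤ B := by
  have key : ∀ t, (playsBefore (p.stoppedPlay σ H' w) t : ℝ) ≤ B := by
    intro t
    induction t with
    | zero => simpa [playsBefore_zero] using hB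
    | succ t ih =>
      by_cases hp : p.stoppedPlay σ H' w t = true
      · obtain ⟨-, h1, h2⟩ := stoppedPlay_iff.1 hp
        refine le_trans ?_ (h t h1 h2)
        exact_mod_cast playsBefore_le_of_imp (fun s hs => (stoppedPlay_iff.1 hs).2.1) (t + 1)
      · rw [playsBefore_succ, if_neg hp]
        simpa using ih
  exact key H'

end DetPolicy

/-! ### The doubling schedule -/

/-- The schedule that plays at the first `2 ^ b` steps of each block `b < L`, and at every step from
block `L` on. -/
def doublingSchedule (δ L t : ℕ) : Bool :=
  decide (L ≤ t / (2 * δ + 1) ∨ t % (2 * δ + 1) < 2 ^ (t / (2 * δ + 1)))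

lemma doublingSchedule_of_le {δ L t : ℕ} (h : blockStart δ L ≤ t) :
    doublingSchedule δ L t = true := by
  simp only [doublingSchedule, decide_eq_true_eq]
  exact Or.inl ((Nat.le_div_iff_mul_le (by omega)).2 h)

lemma doublingSchedule_block {δ L b j : ℕ} (hb : b < L) (hj : j < 2 * δ + 1) :
    doublingSchedule δ L (blockStart δ b + j) = true ↔ j < 2 ^ b := by
  have h1 : (blockStart δ b + j) / (2 * δ + 1) = b := by
    rw [blockStart, mul_comm, Nat.mul_add_div (by omega), Nat.div_eq_of_lt hj, add_zero]
  have h2 : (blockStart δ b + j) % (2 * δ + 1) = j := by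
    rw [blockStart, mul_comm, Nat.mul_add_mod, Nat.mod_eq_of_lt hj]
  simp [doublingSchedule, h1, h2, not_le.2 hb]

lemma blockStart_succ (δ b : ℕ) : blockStart δ (b + 1) = blockStart δ b + (2 * δ + 1) := by
  simp [blockStart, add_mul]

lemma blockStart_mono (δ : ℕ) : Monotone (blockStart δ) := fun _ _ h => Nat.mul_le_mul_right _ h

lemma playsBefore_doublingSchedule_block {δ L b : ℕ} (hb : b < L) (j : ℕ) (hj : j ≤ 2 * δ + 1) :
    playsBefore (doublingSchedule δ L) (blockStart δ b + j) =
      playsBefore (doublingSchedule δ L) (blockStart δ b) + min j (2 ^ b) := by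
  induction j with
  | zero => simp
  | succ j ih =>
    rw [← add_assoc, playsBefore_succ, ih (by omega)]
    have := doublingSchedule_block (L := L) hb (j := j) (δ := δ) (by omega)
    split_ifs with h
    · rw [this] at h; omega
    · rw [this] at h; omega

lemma playsBefore_doublingSchedule_blockStart {δ L b : ℕ} (hL : ∀ b < L, 2 ^ b ≤ δ)
    (hb : b ≤ L) :
    playsBefore (doublingSchedule δ L) (blockStart δ b) + 1 = 2 ^ b := by
  induction b with
  | zero => simp [blockStart, playsBefore_zero]
  | succ b ih =>
    have := hL b hb
    rw [blockStart_succ, playsBefore_doublingSchedule_block hb _ le_rfl, pow_succ]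
    have := ih (by omega)
    omega

/-- The plays of the earlier blocks lie at least `δ` steps before the start of block `b`, so that
all their outcomes are known during block `b`. -/
lemma two_pow_le_known_doublingSchedule {δ L b t : ℕ} (hL : ∀ b < L, 2 ^ b ≤ δ) (hb : b ≤ L)
    (ht : blockStart δ b ≤ t) : 2 ^ b ≤ playsBefore (doublingSchedule δ L) (t - δ) + 1 := by
  cases b with
  | zero => simp
  | succ b =>
    rw [blockStart_succ] at ht
    have h1 := playsBefore_mono (doublingSchedule δ L)
      (by omega : blockStart δ b + (δ + 1) ≤ t - δ)
    rw [playsBefore_doublingSchedule_block hb _ (by omega)] at h1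
    have h2 := playsBefore_doublingSchedule_blockStart hL (by omega : b ≤ L)
    have h3 := hL b hb
    rw [pow_succ]
    omega

/-- Before block `L` at most one play more than doubles the number of known plays. -/
lemma playsBefore_doublingSchedule_le_two_mul {δ L t : ℕ} (hL : ∀ b < L, 2 ^ b ≤ δ)
    (ht : t < blockStart δ L) :
    playsBefore (doublingSchedule δ L) (t + 1) ≤
      2 * playsBefore (doublingSchedule δ L) (t - δ) + 1 := by
  obtain ⟨b, hb⟩ : ∃ b, b = t / (2 * δ + 1) := ⟨_, rfl⟩
  have h1 : blockStart δ b ≤ t := by rw [hb]; exact Nat.div_mul_le_self _ _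
  have h2 : t < blockStart δ (b + 1) := by
    rw [hb, blockStart, mul_comm]; exact Nat.lt_mul_div_succ _ (by omega)
  have h3 : b < L := by
    by_contra h
    exact absurd (blockStart_mono δ (not_lt.1 h)) (by omega)
  have h4 := two_pow_le_known_doublingSchedule hL h3.le h1
  have h5 := playsBefore_doublingSchedule_blockStart hL (by omega : b + 1 ≤ L)
  have h6 := playsBefore_mono (doublingSchedule δ L) (Nat.succ_le_of_lt h2)
  rw [pow_succ] at h5
  simp only [Nat.succ_eq_add_one] at h6
  omega

/-- In the doubling phase the stopped schedule makes fewer than twice as many plays as `p`. In the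
continuous phase it makes at most `δ` additional plays, and `p` makes at least `2 ^ L ≥ c * δ`
plays if this phase is reached. -/
lemma DetPolicy.numPlays_stop_doublingSchedule_le {k δ T H L : ℕ} {c : ℝ} (hc0 : 0 < c)
    (hc1 : c ≤ 1) (hL : ∀ b < L, 2 ^ b ≤ δ) (hcL : c * δ ≤ 2 ^ L) (p : DetPolicy k δ T H)
    (H' : ℕ) (w : Fin T → Fin k) :
    ((p.stopSchedule (doublingSchedule δ L) H').numPlays w : ℝ) ≤
      (1 + 1 / c) * p.numPlays w := by
  have hc : 1 ≤ 1 / c := by rw [le_div_iff₀ hc0]; linarith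
  have hN : (0 : ℝ) ≤ p.numPlays w := Nat.cast_nonneg _
  refine p.numPlays_stopSchedule_le _ _ _ (by positivity) fun t _ ht => ?_
  rcases lt_or_ge t (blockStart δ L) with htL | htL
  · have h1 := playsBefore_doublingSchedule_le_two_mul hL htL
    have h2 : playsBefore (doublingSchedule δ L) (t + 1) ≤ 2 * p.numPlays w := by omega
    have h3 : (playsBefore (doublingSchedule δ L) (t + 1) : ℝ) ≤ 2 * p.numPlays w := by
      exact_mod_cast h2
    nlinarith
  · have h1 := two_pow_le_known_doublingSchedule hL le_rfl htL
    have h2 := playsBefore_add_le (doublingSchedule δ L) (t - δ) (δ + 1)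
    have h3 := playsBefore_mono (doublingSchedule δ L) (by omega : t + 1 ≤ t - δ + (δ + 1))
    have h4 : playsBefore (doublingSchedule δ L) (t + 1) ≤ p.numPlays w + δ := by omega
    have h5 : (playsBefore (doublingSchedule δ L) (t + 1) : ℝ) ≤ p.numPlays w + δ := by
      exact_mod_cast h4
    have h6 : (2 : ℝ) ^ L ≤ p.numPlays w := by exact_mod_cast (by omega : 2 ^ L ≤ p.numPlays w)
    have h7 : (δ : ℝ) ≤ 1 / c * p.numPlays w := by
      rw [one_div_mul_eq_div, le_div_iff₀ hc0]; linarith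
    linarith

/-! ### Well-structured trajectories -/

lemma blockPlays_le {δ b x : ℕ} {a : ℕ → Bool}
    (h : ∀ j < 2 * δ + 1, a (blockStart δ b + j) = true → j < x) : blockPlays δ a b ≤ x := by
  calc blockPlays δ a b ≤ (Finset.range x).card := Finset.card_le_card fun j hj => by
        simp only [Finset.mem_filter, Finset.mem_range] at hj ⊢
        exact h j hj.1 hj.2
    _ = x := Finset.card_range x

lemma min_le_blockPlays {δ b x : ℕ} {a : ℕ → Bool}
    (h : ∀ j < 2 * δ + 1, j < x → a (blockStart δ b + j) = true) :
    min x (2 * δ + 1) ≤ blockPlays δ a b := by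
  calc min x (2 * δ + 1) = (Finset.range (min x (2 * δ + 1))).card := (Finset.card_range _).symm
    _ ≤ blockPlays δ a b := Finset.card_le_card fun j hj => by
        simp only [Finset.mem_filter, Finset.mem_range] at hj ⊢
        exact ⟨by omega, h j (by omega) (by omega)⟩

/-- If few plays are made in a block of a continuous phase, then the phase stops within this block,
which is therefore regular, and the later blocks are empty. -/
lemma isDelayFree_of_playsContinuouslyFrom {c : ℝ} {δ L : ℕ} {a : ℕ → Bool} (hc : c ≤ 1)
    (hreg : ∀ b < L, IsRegularBlock δ a b ∧ (blockPlays δ a b : ℝ) < c * δ)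
    (hcont : PlaysContinuouslyFrom a (blockStart δ L)) : IsDelayFree c δ a := by
  intro b _
  obtain ⟨e, he⟩ := hcont
  refine ⟨fun hb => ?_, fun hb => ?_⟩
  · rcases lt_or_ge b L with hbL | hbL
    · exact (hreg b hbL).1
    · have hs := blockStart_mono δ hbL
      have hiff : ∀ j < 2 * δ + 1,
          (a (blockStart δ b + j) = true ↔ j < e - blockStart δ b) := fun j _ => by
        rw [he _ (by omega)]; omega
      refine ⟨e - blockStart δ b, ?_, hiff⟩
      have h1 := min_le_blockPlays fun j hj hjx => (hiff j hj).2 hjx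
      have h2 : (blockPlays δ a b : ℝ) < (δ + 1 : ℕ) := by
        push_cast
        nlinarith [(Nat.cast_nonneg δ : (0 : ℝ) ≤ δ)]
      have h3 : blockPlays δ a b < δ + 1 := by exact_mod_cast h2
      omega
  · rcases lt_or_ge b L with hbL | hbL
    · exact absurd (hreg b hbL).2 (not_lt.2 hb)
    · exact ⟨e, fun t ht => he t ((blockStart_mono δ hbL).trans ht)⟩

lemma DetPolicy.isWellStructuredTrajectory_stop_doublingSchedule {k δ T H L : ℕ} {c q : ℝ}
    (hc : c ≤ 1) (hL : ∀ b < L, (2 : ℝ) ^ b < c * δ) (hq : (L : ℝ) ≤ q)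
    (p : DetPolicy k δ T H) (H' : ℕ) (w : Fin T → Fin k) :
    IsWellStructuredTrajectory c q δ ((p.stopSchedule (doublingSchedule δ L) H').play w) := by
  have hcont : PlaysContinuouslyFrom ((p.stopSchedule (doublingSchedule δ L) H').play w)
      (blockStart δ L) := by
    refine exists_forall_iff_lt_of_antitone (H := H') (fun t u ht htu hu => ?_) fun t ht => ?_
    · obtain ⟨h1, h2, h3⟩ := DetPolicy.stoppedPlay_iff.1 hu
      exact DetPolicy.stoppedPlay_iff.2 ⟨by omega, doublingSchedule_of_le ht,
        (playsBefore_mono _ (by omega)).trans_lt h3⟩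
    · simp [DetPolicy.horizon _ w t ht]
  refine ⟨isDelayFree_of_playsContinuouslyFrom hc (fun b hb => ?_) hcont, L, hq, hcont⟩
  have hbδ : 2 ^ b ≤ δ := by
    have h1 : (2 : ℝ) ^ b < δ :=
      (hL b hb).trans_le (mul_le_of_le_one_left (Nat.cast_nonneg δ) hc)
    exact_mod_cast h1.le
  have hpow : ∀ j < 2 * δ + 1,
      (p.stopSchedule (doublingSchedule δ L) H').play w (blockStart δ b + j) = true →
        j < 2 ^ b := fun j hj h =>
    (doublingSchedule_block hb hj).1 (DetPolicy.stoppedPlay_iff.1 h).2.1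
  constructor
  · have hanti : ∀ j j', 0 ≤ j → j ≤ j' →
        (j' < 2 ^ b ∧
          (p.stopSchedule (doublingSchedule δ L) H').play w (blockStart δ b + j') = true) →
        j < 2 ^ b ∧
          (p.stopSchedule (doublingSchedule δ L) H').play w (blockStart δ b + j) = true := by
      intro j j' _ hjj' hj'
      obtain ⟨h1, h2, h3⟩ := DetPolicy.stoppedPlay_iff.1 hj'.2
      exact ⟨by omega, DetPolicy.stoppedPlay_iff.2 ⟨by omega,
        (doublingSchedule_block hb (by omega)).2 (by omega),
        (playsBefore_mono _ (by omega)).trans_lt h3⟩⟩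
    obtain ⟨x, hx⟩ := exists_forall_iff_lt_of_antitone (H := 2 ^ b) hanti fun j hj h => by omega
    refine ⟨x, ?_, fun j hj => ?_⟩
    · by_contra hlt
      have := ((hx (δ + 1) (by omega)).2 (by omega)).1
      omega
    · rw [← hx j (by omega)]
      exact ⟨fun h => ⟨hpow j hj h, h⟩, fun h => h.2⟩
  · refine lt_of_le_of_lt ?_ (hL b hb)
    exact_mod_cast blockPlays_le hpow

/-- The doubling schedule wastes at most the time before block `L`. -/
lemma sub_le_playsBefore_doublingSchedule (δ L t : ℕ) :
    t - blockStart δ L ≤ playsBefore (doublingSchedule δ L) t := by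
  rcases le_total t (blockStart δ L) with h | h
  · omega
  · have := playsBefore_add_of_forall_true
      (a := doublingSchedule δ L) (fun s hs => doublingSchedule_of_le hs) (t - blockStart δ L)
    rw [Nat.add_sub_cancel' h] at this
    omega

/-! ### Expected rewards -/

instance DetPolicy.instFinite (k δ T H : ℕ) : Finite (DetPolicy k δ T H) := by
  refine Finite.of_injective
    (fun p (w : Fin T → Fin k) (t : Fin H) => p.play w t) fun p q h => ?_
  obtain ⟨f, hf, _⟩ := p
  obtain ⟨g, hg, _⟩ := q
  have : f = g := by
    funext w t
    rcases lt_or_ge t H with ht | ht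
    · exact congr_fun (congr_fun h w) ⟨t, ht⟩
    · rw [hf w t ht, hg w t ht]
  subst this
  rfl

namespace Arm

variable (A : Arm) {T : ℕ}

/-- The probability of the outcome tape `w`, averaged over the prior. -/
noncomputable def tapeWeight (w : Fin T → Fin A.numOutcomes) : ℝ := ∫ D, A.tapeProb D w ∂A.prior

lemma tapeProb_mem_Icc {D : Fin A.numOutcomes → ℝ} (hD : D ∈ stdSimplex ℝ (Fin A.numOutcomes))
    (w : Fin T → Fin A.numOutcomes) : A.tapeProb D w ∈ Set.Icc (0 : ℝ) 1 :=
  ⟨Finset.prod_nonneg fun _ _ => hD.1 _,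
    Finset.prod_le_one (fun _ _ => hD.1 _) fun j _ => (mem_Icc_of_mem_stdSimplex hD (w j)).2⟩

lemma integrable_tapeProb (w : Fin T → Fin A.numOutcomes) :
    Integrable (fun D => A.tapeProb D w) A.prior := by
  have := A.prior_prob
  refine Integrable.of_bound (C := 1) ?_ ?_
  · unfold tapeProb
    exact (Finset.measurable_prod _ fun j _ => measurable_pi_apply (w j)).aestronglyMeasurable
  · filter_upwards [A.prior_simplex] with D hD
    have := A.tapeProb_mem_Icc hD w
    rw [Real.norm_of_nonneg this.1]
    exact this.2

lemma tapeWeight_nonneg (w : Fin T → Fin A.numOutcomes) : 0 ≤ A.tapeWeight w := by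
  refine integral_nonneg_of_ae ?_
  filter_upwards [A.prior_simplex] with D hD
  exact (A.tapeProb_mem_Icc hD w).1

lemma expect_eq (f : (Fin T → Fin A.numOutcomes) → ℝ) :
    A.expect f = ∑ w, A.tapeWeight w * f w := by
  unfold expect tapeWeight
  rw [integral_finsetSum _ fun w _ => (A.integrable_tapeProb w).mul_const _]
  simp_rw [integral_mul_const]

lemma expect_mono {f g : (Fin T → Fin A.numOutcomes) → ℝ} (h : ∀ w, f w ≤ g w) :
    A.expect f ≤ A.expect g := by
  rw [expect_eq, expect_eq]
  exact Finset.sum_le_sum fun w _ => mul_le_mul_of_nonneg_left (h w) (A.tapeWeight_nonneg w)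

lemma expect_nonneg {f : (Fin T → Fin A.numOutcomes) → ℝ} (h : ∀ w, 0 ≤ f w) :
    0 ≤ A.expect f := by
  rw [expect_eq]
  exact Finset.sum_nonneg fun w _ => mul_nonneg (A.tapeWeight_nonneg w) (h w)

lemma expect_const_mul (r : ℝ) (f : (Fin T → Fin A.numOutcomes) → ℝ) :
    A.expect (fun w => r * f w) = r * A.expect f := by
  rw [expect_eq, expect_eq, Finset.mul_sum]
  exact Finset.sum_congr rfl fun w _ => by ring

lemma expect_sum {ι : Type*} (s : Finset ι) (f : ι → (Fin T → Fin A.numOutcomes) → ℝ) :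
    A.expect (fun w => ∑ i ∈ s, f i w) = ∑ i ∈ s, A.expect (f i) := by
  simp_rw [expect_eq, Finset.mul_sum]
  exact Finset.sum_comm

/-- The outcomes of the plays are exchangeable. -/
lemma expect_comp_perm (e : Equiv.Perm (Fin T)) (f : (Fin T → Fin A.numOutcomes) → ℝ) :
    A.expect (fun w => f (w ∘ e)) = A.expect f := by
  rw [expect_eq, expect_eq]
  refine Fintype.sum_equiv (Equiv.arrowCongr e.symm (Equiv.refl _)) _ _ fun w => ?_
  have h1 : (Equiv.arrowCongr e.symm (Equiv.refl (Fin A.numOutcomes))) w = w ∘ e := by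
    ext i; simp [Equiv.arrowCongr]
  have h2 : A.tapeWeight (w ∘ e) = A.tapeWeight w := by
    unfold tapeWeight tapeProb
    congr 1
    funext D
    exact Equiv.prod_comp e fun j => D (w j)
  rw [h1, h2]

lemma playReward_nonneg (w : Fin T → Fin A.numOutcomes) (j : Fin T) : 0 ≤ A.playReward w j := by
  unfold playReward
  split_ifs
  exacts [A.value_nonneg _, le_rfl]

/-- Play `j` is made by the policy `p` while the budget is not used up. -/
def IsRewarded {H : ℕ} (p : DetPolicy A.numOutcomes A.delay T H) (w : Fin T → Fin A.numOutcomes)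
    (j : Fin T) : Prop :=
  (j : ℕ) < p.numPlays w ∧
    ENNReal.ofReal (∑ j' ∈ Finset.univ.filter (fun j' : Fin T => j' < j), A.value (w j')) < A.budget

lemma IsRewarded.of_le {A : Arm} {H : ℕ} {p : DetPolicy A.numOutcomes A.delay T H}
    {w : Fin T → Fin A.numOutcomes} {i j : Fin T} (h : A.IsRewarded p w j) (hij : i ≤ j) :
    A.IsRewarded p w i := by
  refine ⟨lt_of_le_of_lt hij h.1, lt_of_le_of_lt (ENNReal.ofReal_le_ofReal ?_) h.2⟩
  refine Finset.sum_le_sum_of_subset_of_nonneg (fun l hl => ?_) fun l _ _ => A.value_nonneg _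
  simp only [Finset.mem_filter, Finset.mem_univ, true_and] at hl ⊢
  exact hl.trans_le hij

/-- Whether play `j` is rewarded depends on the earlier outcomes only. -/
lemma IsRewarded.of_agree {A : Arm} {H : ℕ} {p : DetPolicy A.numOutcomes A.delay T H}
    {w w' : Fin T → Fin A.numOutcomes} {j : Fin T} (h : A.IsRewarded p w j)
    (hw : ∀ i < j, w i = w' i) : A.IsRewarded p w' j := by
  refine ⟨p.lt_numPlays_of_agree (fun i hi => hw i hi) h.1, ?_⟩
  have hsum : ∑ i ∈ Finset.univ.filter (· < j), A.value (w' i) =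
      ∑ i ∈ Finset.univ.filter (· < j), A.value (w i) :=
    Finset.sum_congr rfl fun i hi => by rw [hw i (Finset.mem_filter.1 hi).2]
  rw [hsum]
  exact h.2

open Classical in
/-- The expected reward that the policy `p` draws from play `j`. -/
noncomputable def expectedPlayReward {H : ℕ} (p : DetPolicy A.numOutcomes A.delay T H) (j : Fin T) : ℝ :=
  A.expect fun w => if A.IsRewarded p w j then A.value (w j) else 0

/-- Later plays are made and rewarded less often than earlier ones, and given the outcomes
`0, …, i - 1` all further outcomes have the same conditional law. -/
lemma antitone_expectedPlayReward {H : ℕ} (p : DetPolicy A.numOutcomes A.delay T H) :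
    Antitone (A.expectedPlayReward p) := by
  classical
  intro i j hij
  unfold expectedPlayReward
  rw [← A.expect_comp_perm (Equiv.swap i j)
    (fun w => if A.IsRewarded p w i then A.value (w i) else 0)]
  refine A.expect_mono fun w => ?_
  simp only [Function.comp_apply, Equiv.swap_apply_left]
  by_cases h : A.IsRewarded p w j
  · have hw : ∀ l < i, w l = (w ∘ Equiv.swap i j) l := fun l hl => by
      rw [Function.comp_apply, Equiv.swap_apply_of_ne_of_ne hl.ne (hl.trans_le hij).ne]
    rw [if_pos h, if_pos ((h.of_le hij).of_agree hw)]
  · rw [if_neg h]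
    split_ifs
    exacts [A.value_nonneg _, le_rfl]

lemma expect_sum_filter_lt_numPlays {H : ℕ} (p : DetPolicy A.numOutcomes A.delay T H)
    (s : Finset (Fin T)) :
    A.expect (fun w => ∑ j ∈ s.filter (fun j : Fin T => (j : ℕ) < p.numPlays w),
      A.playReward w j) = ∑ j ∈ s, A.expectedPlayReward p j := by
  classical
  unfold expectedPlayReward
  rw [← A.expect_sum]
  congr 1
  funext w
  rw [Finset.sum_filter]
  refine Finset.sum_congr rfl fun j _ => ?_
  unfold playReward IsRewarded
  rw [← ite_and]
  congr

lemma totalReward_nonneg {H : ℕ} (p : DetPolicy A.numOutcomes A.delay T H)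
    (w : Fin T → Fin A.numOutcomes) : 0 ≤ A.totalReward p w :=
  Finset.sum_nonneg fun j _ => A.playReward_nonneg w j

/-- A policy that matches the first `K` plays of `p` draws at least the fraction `K / T` of the
expected reward of `p`, because the expected rewards of the plays decrease. -/
lemma mul_expect_totalReward_le {H H' K : ℕ} (hK : K ≤ T)
    (p : DetPolicy A.numOutcomes A.delay T H) (p' : DetPolicy A.numOutcomes A.delay T H')
    (h : ∀ w, min (p.numPlays w) K ≤ p'.numPlays w) :
    (K : ℝ) * A.expect (A.totalReward p) ≤ T * A.expect (A.totalReward p') := by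
  classical
  have h1 : A.expect (A.totalReward p) = ∑ j, A.expectedPlayReward p j :=
    A.expect_sum_filter_lt_numPlays p Finset.univ
  have h2 : ∑ j ∈ Finset.univ.filter (fun j : Fin T => (j : ℕ) < K), A.expectedPlayReward p j ≤
      A.expect (A.totalReward p') := by
    rw [← expect_sum_filter_lt_numPlays]
    refine A.expect_mono fun w => ?_
    refine Finset.sum_le_sum_of_subset_of_nonneg (fun j hj => ?_) fun j _ _ =>
      A.playReward_nonneg w j
    simp only [Finset.mem_filter, Finset.mem_univ, true_and] at hj ⊢
    have := h w
    omega
  have hind : Antitone fun j : Fin T => if (j : ℕ) < K then (1 : ℝ) else 0 := by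
    intro i j hij
    have : (i : ℕ) ≤ j := hij
    dsimp only
    split_ifs <;> first | omega | norm_num
  -- Chebyshev's sum inequality for the expected rewards and the indicator of the first `K` plays
  have h3 := ((A.antitone_expectedPlayReward p).monovary hind).sum_mul_sum_le_card_mul_sum
  have h4 : ∑ j : Fin T, (if (j : ℕ) < K then (1 : ℝ) else 0) = K := by
    rw [Finset.sum_boole, Fin.card_filter_val_lt, min_eq_right hK]
  simp only [h4, mul_ite, mul_one, mul_zero, Fintype.card_fin, ← Finset.sum_filter] at h3
  rw [h1, mul_comm]
  exact h3.trans (mul_le_mul_of_nonneg_left h2 (Nat.cast_nonneg T))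

/-! ### Randomized policies -/

variable {A} {H : ℕ}

lemma Policy.sum_toReal (P : A.Policy T H) [Fintype (DetPolicy A.numOutcomes A.delay T H)] :
    ∑ p, (P p).toReal = 1 := by
  rw [← ENNReal.toReal_sum fun p _ => P.apply_ne_top p, ←
    tsum_fintype (L := SummationFilter.unconditional _), P.tsum_coe,
    ENNReal.toReal_one]

/-- The law of total expectation for a policy that is transformed along `f`. -/
lemma Policy.tsum_map {H' : ℕ} (P : A.Policy T H)
    (f : DetPolicy A.numOutcomes A.delay T H → DetPolicy A.numOutcomes A.delay T H')
    (g : DetPolicy A.numOutcomes A.delay T H' → ℝ) :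
    ∑' p', ((P.map f) p').toReal * g p' = ∑' p, (P p).toReal * g (f p) := by
  classical
  have := Fintype.ofFinite (DetPolicy A.numOutcomes A.delay T H)
  have := Fintype.ofFinite (DetPolicy A.numOutcomes A.delay T H')
  have h : ∀ p', ((P.map f) p').toReal = ∑ p, if p' = f p then (P p).toReal else 0 := fun p' => by
    rw [PMF.map_apply, tsum_fintype, ENNReal.toReal_sum]
    · refine Finset.sum_congr rfl fun p _ => ?_
      split_ifs <;> simp
    · intro p _
      split_ifs
      exacts [P.apply_ne_top p, ENNReal.zero_ne_top]
  simp_rw [tsum_fintype, h, Finset.sum_mul]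
  rw [Finset.sum_comm]
  refine Finset.sum_congr rfl fun p _ => ?_
  simp [ite_mul]

lemma Policy.tsum_mono (P : A.Policy T H) {f g : DetPolicy A.numOutcomes A.delay T H → ℝ}
    (h : ∀ p, f p ≤ g p) : ∑' p, (P p).toReal * f p ≤ ∑' p, (P p).toReal * g p :=
  Summable.tsum_le_tsum (fun p => mul_le_mul_of_nonneg_left (h p) ENNReal.toReal_nonneg)
    .of_finite .of_finite

lemma Policy.R_nonneg (P : A.Policy T H) : 0 ≤ P.R :=
  tsum_nonneg fun p => mul_nonneg ENNReal.toReal_nonneg (A.expect_nonneg (A.totalReward_nonneg p))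

lemma Policy.R_le (P : A.Policy T H) :
    P.R ≤ A.expect fun w : Fin T → Fin A.numOutcomes => ∑ j, A.playReward w j := by
  have := Fintype.ofFinite (DetPolicy A.numOutcomes A.delay T H)
  refine (P.tsum_mono fun p => A.expect_mono fun w => Finset.sum_le_sum_of_subset_of_nonneg
    (Finset.filter_subset _ _) fun j _ _ => A.playReward_nonneg w j).trans_eq ?_
  rw [tsum_fintype, ← Finset.sum_mul, P.sum_toReal, one_mul]

lemma Policy.N_map_le {H' : ℕ} (P : A.Policy T H)
    (f : DetPolicy A.numOutcomes A.delay T H → DetPolicy A.numOutcomes A.delay T H') {r : ℝ}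
    (h : ∀ p w, ((f p).numPlays w : ℝ) ≤ r * p.numPlays w) :
    Policy.N (P.map f : A.Policy T H') ≤ r * P.N := by
  unfold Policy.N
  rw [P.tsum_map f fun p' => A.expect fun w => (p'.numPlays w : ℝ), ← tsum_mul_left]
  simp_rw [mul_left_comm r]
  refine P.tsum_mono fun p => ?_
  rw [← A.expect_const_mul]
  exact A.expect_mono (h p)

lemma Policy.mul_R_le_R_map {H' K : ℕ} (hK : K ≤ T) (P : A.Policy T H)
    (f : DetPolicy A.numOutcomes A.delay T H → DetPolicy A.numOutcomes A.delay T H')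
    (h : ∀ p w, min (p.numPlays w) K ≤ (f p).numPlays w) :
    (K : ℝ) * P.R ≤ T * Policy.R (P.map f : A.Policy T H') := by
  unfold Policy.R
  rw [P.tsum_map f fun p' => A.expect fun w => A.totalReward p' w, ← tsum_mul_left,
    ← tsum_mul_left]
  simp_rw [mul_left_comm _ (ENNReal.toReal _)]
  exact P.tsum_mono fun p => A.mul_expect_totalReward_le hK p (f p) (h p)

end Arm

/-- The policy that never plays. -/
def DetPolicy.idle (k δ T H : ℕ) : DetPolicy k δ T H where
  play _ _ := false
  horizon _ _ _ := rfl
  adapted _ _ _ _ := rfl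

lemma lp1Values_nonempty {n : ℕ} (arms : Fin n → Arm) (T : ℕ) : (lp1Values arms T).Nonempty := by
  refine ⟨_, fun i => PMF.pure (DetPolicy.idle _ _ _ _), ?_, rfl⟩
  refine (Finset.sum_nonpos fun i _ => ?_).trans (Nat.cast_nonneg T)
  refine tsum_nonpos fun p => ?_
  rcases eq_or_ne p (DetPolicy.idle _ _ _ _) with rfl | hp
  · simp [DetPolicy.numPlays, DetPolicy.idle, playsBefore, Arm.expect]
  · simp [PMF.pure_apply, hp]

lemma bddAbove_lp1Values {n : ℕ} (arms : Fin n → Arm) (T : ℕ) : BddAbove (lp1Values arms T) := by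
  refine ⟨∑ i, (arms i).expect fun w : Fin T → Fin (arms i).numOutcomes =>
    ∑ j, (arms i).playReward w j, ?_⟩
  rintro v ⟨P, -, rfl⟩
  exact Finset.sum_le_sum fun i _ => (P i).R_le

/-- Some feasible solution attains at least half the optimum, which is nonnegative. -/
lemma exists_half_lp1_le {n : ℕ} (arms : Fin n → Arm) (T : ℕ) :
    ∃ P : ∀ i, (arms i).Policy T T, (∑ i, Arm.Policy.N (P i)) ≤ (T : ℝ) ∧
      lp1 arms T / 2 ≤ ∑ i, Arm.Policy.R (P i) := by
  by_cases h : 0 < lp1 arms T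
  · obtain ⟨v, ⟨P, hP, rfl⟩, hv⟩ :=
      exists_lt_of_lt_csSup (lp1Values_nonempty arms T) (half_lt_self h)
    exact ⟨P, hP, hv.le⟩
  · obtain ⟨v, P, hP, rfl⟩ := lp1Values_nonempty arms T
    exact ⟨P, hP, by linarith [Finset.sum_nonneg fun i (_ : i ∈ Finset.univ) => (P i).R_nonneg]⟩

/-! ### Asymptotics -/

/-- The number of blocks of the doubling phase: the least `L` with `c * δ ≤ 2 ^ L`. -/
noncomputable def doublingBlocks (c : ℝ) (δ : ℕ) : ℕ := Nat.clog 2 ⌈c * δ⌉₊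

lemma le_two_pow_doublingBlocks (c : ℝ) (δ : ℕ) : c * δ ≤ 2 ^ doublingBlocks c δ :=
  (Nat.le_ceil _).trans (by exact_mod_cast Nat.le_pow_clog one_lt_two _)

lemma two_pow_lt_of_lt_doublingBlocks {c : ℝ} {δ b : ℕ} (h : b < doublingBlocks c δ) :
    (2 : ℝ) ^ b < c * δ := by
  have : 2 ^ b < ⌈c * δ⌉₊ := (Nat.lt_clog_iff_pow_lt one_lt_two).1 h
  exact_mod_cast Nat.lt_ceil.1 this

lemma doublingBlocks_zero (c : ℝ) : doublingBlocks c 0 = 0 := by simp [doublingBlocks]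

lemma doublingBlocks_le {c : ℝ} {δ T : ℕ} (hc : c ≤ 1) (hT : 3 ≤ T) (hδ : δ ≤ T) :
    (doublingBlocks c δ : ℝ) ≤ 3 * Real.log T := by
  have hT3 : (3 : ℝ) ≤ T := by exact_mod_cast hT
  have h1 : 1 ≤ Real.log T := by
    rw [Real.le_log_iff_exp_le (by linarith)]
    exact (Real.exp_one_lt_d9.le.trans (by norm_num)).trans hT3
  rcases Nat.eq_zero_or_eq_succ_pred (doublingBlocks c δ) with h | h
  · rw [h]; push_cast; linarith
  · obtain ⟨b, hb⟩ : ∃ b, doublingBlocks c δ = b + 1 := ⟨_, h⟩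
    have h2 : (2 : ℝ) ^ b < c * δ := two_pow_lt_of_lt_doublingBlocks (by omega)
    have h3 : (δ : ℝ) ≤ T := by exact_mod_cast hδ
    have h4 : (2 : ℝ) ^ b ≤ T := by nlinarith [(Nat.cast_nonneg δ : (0 : ℝ) ≤ δ)]
    have h5 := Real.log_le_log (by positivity) h4
    rw [Real.log_pow] at h5
    rw [hb]
    push_cast
    nlinarith [Real.log_two_gt_d9, (Nat.cast_nonneg b : (0 : ℝ) ≤ b)]

/-- For delays of order `o(T / log T)` the doubling phase is short. -/
lemma eventually_doublingBlocks_mul_le {c η : ℝ} (hc : c ≤ 1) (hη : 0 < η) {d : ℕ → ℝ}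
    (hd : d =o[atTop] fun T : ℕ => (T : ℝ) / Real.log T) :
    ∀ᶠ T : ℕ in atTop, ∀ δ : ℕ, (δ : ℝ) ≤ d T → (doublingBlocks c δ : ℝ) * δ ≤ η * T := by
  filter_upwards [hd.bound (lt_min (by positivity : 0 < η / 3) one_pos), eventually_ge_atTop 3]
    with T hT hT3 δ hδ
  have hT3' : (3 : ℝ) ≤ T := by exact_mod_cast hT3
  have h1 : 1 ≤ Real.log T := by
    rw [Real.le_log_iff_exp_le (by linarith)]
    exact (Real.exp_one_lt_d9.le.trans (by norm_num)).trans hT3'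
  rw [Real.norm_of_nonneg (by positivity : (0 : ℝ) ≤ T / Real.log T)] at hT
  have h2 : (δ : ℝ) ≤ min (η / 3) 1 * (T / Real.log T) := hδ.trans ((le_abs_self _).trans hT)
  have h3 : (δ : ℝ) ≤ η / 3 * (T / Real.log T) :=
    h2.trans (mul_le_mul_of_nonneg_right (min_le_left _ _) (by positivity))
  have h4 : (δ : ℝ) ≤ T := by
    refine h2.trans ((mul_le_mul_of_nonneg_right (min_le_right _ _) (by positivity)).trans ?_)
    rw [one_mul]
    exact div_le_self (by linarith) h1
  have h5 := doublingBlocks_le hc hT3 (by exact_mod_cast h4 : δ ≤ T)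
  calc (doublingBlocks c δ : ℝ) * δ ≤ 3 * Real.log T * (η / 3 * (T / Real.log T)) := by gcongr
    _ = η * T := by field_simp

theorem theorem4 (α : ℝ) (hα0 : 0 < α) (hα : α ≤ 1 / 8)
    (d : ℕ → ℝ) (hd : d =o[atTop] fun T : ℕ => (T : ℝ) / Real.log T) :
    ∃ ε : ℕ → ℝ, Tendsto ε atTop (𝓝 0) ∧
      ∀ᶠ T : ℕ in atTop, ∀ (n : ℕ) (arms : Fin n → Arm),
        (∀ i, ((arms i).delay : ℝ) ≤ d T) →
        BddAbove (lp1Values arms T) ∧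
        ∃ P : ∀ i, (arms i).Policy T (T / 2),
          (∀ i, Arm.Policy.IsWellStructured (P i) α (α / (α + 2)) (ε T)) ∧
          (∑ i, Arm.Policy.N (P i)) ≤ 2 * (1 + 1 / α) * (1 + 2 / α) * (T : ℝ) ∧
          lp1 arms T ≤ 1 / α * ∑ i, Arm.Policy.R (P i) := by
  obtain ⟨c, hc⟩ : ∃ c, c = α / (α + 2) := ⟨_, rfl⟩
  have hc0 : 0 < c := by rw [hc]; positivity
  have hc1 : c ≤ 1 := by rw [hc, div_le_one (by linarith)]; linarith
  -- The doubling phase takes `o(T / δ)` blocks, so that the allowance `α * (T / δ)` alone suffices.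
  refine ⟨fun _ => 0, tendsto_const_nhds, ?_⟩
  rw [← hc]
  filter_upwards [eventually_doublingBlocks_mul_le hc1
    (lt_min hα0 (by norm_num : 0 < (1 : ℝ) / 24)) hd, eventually_ge_atTop 8] with T hT hT8 n arms harms
  refine ⟨bddAbove_lp1Values arms T, ?_⟩
  obtain ⟨P, hPN, hPR⟩ := exists_half_lp1_le arms T
  have hT8' : (8 : ℝ) ≤ T := by exact_mod_cast hT8
  have hpow : ∀ (δ : ℕ), ∀ b < doublingBlocks c δ, 2 ^ b ≤ δ := fun δ b hb => by
    have h1 : (2 : ℝ) ^ b < δ := (two_pow_lt_of_lt_doublingBlocks hb).trans_le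
      (mul_le_of_le_one_left (Nat.cast_nonneg δ) hc1)
    exact_mod_cast h1.le
  let f : ∀ i, DetPolicy (arms i).numOutcomes (arms i).delay T T →
      DetPolicy (arms i).numOutcomes (arms i).delay T (T / 2) := fun i p =>
    p.stopSchedule (doublingSchedule (arms i).delay (doublingBlocks c (arms i).delay)) (T / 2)
  refine ⟨fun i => (P i).map (f i), fun i p' hp' w => ?_, ?_, ?_⟩
  · obtain ⟨p, -, rfl⟩ := (PMF.mem_support_map_iff _ _ _).1 hp'
    refine p.isWellStructuredTrajectory_stop_doublingSchedule hc1
      (fun b => two_pow_lt_of_lt_doublingBlocks) ?_ _ w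
    rcases Nat.eq_zero_or_pos (arms i).delay with h0 | h0
    · simp [h0, doublingBlocks_zero]
    · have h1 : (0 : ℝ) < (arms i).delay := by exact_mod_cast h0
      rw [add_zero, ← mul_div_assoc, le_div_iff₀ h1]
      exact (hT _ (harms i)).trans
        (mul_le_mul_of_nonneg_right (min_le_left _ _) (Nat.cast_nonneg T))
  · have h1 : ∀ i, Arm.Policy.N ((P i).map (f i) : (arms i).Policy T (T / 2)) ≤
        (1 + 1 / c) * (P i).N := fun i => (P i).N_map_le (f i) fun p w =>
      p.numPlays_stop_doublingSchedule_le hc0 hc1 (hpow _) (le_two_pow_doublingBlocks c _) _ w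
    have h2 : 1 + 1 / c = 2 * (1 + 1 / α) := by rw [hc]; field_simp; ring
    calc _ ≤ ∑ i, (1 + 1 / c) * (P i).N := Finset.sum_le_sum fun i _ => h1 i
      _ = (1 + 1 / c) * ∑ i, (P i).N := (Finset.mul_sum _ _ _).symm
      _ ≤ (1 + 1 / c) * T := by gcongr
      _ ≤ _ := by
        rw [h2]
        refine mul_le_mul_of_nonneg_right ?_ (Nat.cast_nonneg T)
        exact le_mul_of_one_le_right (by positivity) (by linarith [(by positivity : 0 ≤ 2 / α)])
  -- The doubling phase takes at most `T / 8` steps; at least `T / 4` steps of the horizon remain.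
  · have h1 : ∀ i, (T : ℝ) * (P i).R ≤
        T * (4 * Arm.Policy.R ((P i).map (f i) : (arms i).Policy T (T / 2))) := fun i => by
      obtain ⟨δ, hδ⟩ : ∃ δ, δ = (arms i).delay := ⟨_, rfl⟩
      obtain ⟨L, hL⟩ : ∃ L, L = doublingBlocks c δ := ⟨_, rfl⟩
      have h2 : (8 : ℝ) * blockStart δ L ≤ T := by
        rcases Nat.eq_zero_or_pos δ with h0 | h0
        · rw [hL, h0, doublingBlocks_zero]; simp [blockStart]
        · have h3 : (L : ℝ) * δ ≤ 1 / 24 * T := by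
            rw [hL]
            refine (hT δ (hδ ▸ harms i)).trans
              (mul_le_mul_of_nonneg_right (min_le_right _ _) (Nat.cast_nonneg T))
          have h4 : (1 : ℝ) ≤ δ := by exact_mod_cast h0
          have h5 : (L : ℝ) ≤ L * δ := le_mul_of_one_le_right (Nat.cast_nonneg L) h4
          simp only [blockStart]
          push_cast
          linarith
      have h3 : 8 * blockStart δ L ≤ T := by exact_mod_cast h2
      have h4 := (P i).mul_R_le_R_map (K := T / 2 - blockStart δ L) (by omega) (f i) fun p w => by
        refine le_trans (min_le_min le_rfl ?_) (p.min_le_numPlays_stopSchedule _ _ w)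
        rw [hL, hδ]
        exact sub_le_playsBefore_doublingSchedule _ _ _
      have h5 : (T : ℝ) ≤ 4 * (T / 2 - blockStart δ L : ℕ) := by
        exact_mod_cast (by omega : T ≤ 4 * (T / 2 - blockStart δ L))
      nlinarith [(P i).R_nonneg]
    have h2 : ∑ i, (P i).R ≤
        4 * ∑ i, Arm.Policy.R ((P i).map (f i) : (arms i).Policy T (T / 2)) := by
      rw [Finset.mul_sum]
      exact Finset.sum_le_sum fun i _ => le_of_mul_le_mul_left (h1 i) (by linarith)
    have h3 : 0 ≤ ∑ i, Arm.Policy.R ((P i).map (f i) : (arms i).Policy T (T / 2)) :=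
      Finset.sum_nonneg fun i _ => Arm.Policy.R_nonneg _
    have h4 : 8 ≤ 1 / α := by rw [le_div_iff₀ hα0]; linarith
    nlinarith
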